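/- Let $K$ be a field of characteristic zero and let $n\ge 3$ be an integer. Let $K_n$ be the complete graph on $n$ vertices with edge set $E(K_n)$, and assign a variable $x_e$ to each edge $e$. Let $$F_{K_n}=\sum_{T}\prod_{e\in E(T)}x_e\in K[x_e : e\in E(K_n)]$$ be its Kirchhoff polynomial, where $T$ runs over all spanning trees of $K_n$. Let $$H_{K_n}=\left(\frac{\partial}{\partial x_i}\frac{\partial}{\partial x_j}F_{K_n}\right)_{i,j\in E(K_n)}$$ be the Hessian matrix of $K_n$, and let $\tilde H_{K_n}$ be the matrix obtained from $H_{K_n}$ by setting $x_e=1$ for all $e\in E(K_n)$. Then $$\det\tilde H_{K_n}=(-1)^{\binom n2-1}\,2^{\binom n2-n+1}\,n^{\,n+\binom n2(n-4)}\,(n-2).$$ Hence the Hessian $\det H_{K_n}$ is not the zero polynomial. -/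

import Mathlib

noncomputable section

/-- The finite set of spanning trees of a finite simple graph `G`: the subgraphs of `G` on the
whole vertex set `V` that are trees. -/
def spanningTrees {V : Type*} [Fintype V] (G : SimpleGraph V) : Finset (SimpleGraph V) :=
  (Set.toFinite {T : SimpleGraph V | T ≤ G ∧ T.IsTree}).toFinset

open Classical in
/-- The Kirchhoff polynomial `∑_T ∏_{e ∈ E(T)} x_e` of `G`, where `T` runs over the spanning trees
of `G`, in the polynomial ring over `K` with one variable `x_e` for each edge `e` of `G`. -/
def kirchhoffPolynomial (K : Type*) [Field K] {V : Type*} [Fintype V] (G : SimpleGraph V) :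
    MvPolynomial G.edgeSet K :=
  ∑ T ∈ spanningTrees G, ∏ e ∈ Finset.univ.filter (fun e : G.edgeSet => e.val ∈ T.edgeSet),
    MvPolynomial.X e

/-- The Hessian matrix of `G`: the matrix of second partial derivatives of the
Kirchhoff polynomial. -/
def hessianMatrix (K : Type*) [Field K] {V : Type*} [Fintype V] (G : SimpleGraph V) :
    Matrix G.edgeSet G.edgeSet (MvPolynomial G.edgeSet K) :=
  Matrix.of fun i j =>
    MvPolynomial.pderiv i (MvPolynomial.pderiv j (kirchhoffPolynomial K G))

/-- The value of the Hessian matrix of `G` at the point where all variables equal `1`. -/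
def hessianMatrixAtOne (K : Type*) [Field K] {V : Type*} [Fintype V] (G : SimpleGraph V) :
    Matrix G.edgeSet G.edgeSet K :=
  (hessianMatrix K G).map (MvPolynomial.eval fun _ => (1 : K))

end

/-! ### Counting the trees that contain a given forest -/

namespace SimpleGraph

open Finset

variable {V : Type*}

/-! A forest on `n` vertices with component sizes `m_1, ..., m_c` lies in `n ^ (c - 2) * ∏ m_i`
trees (`IsForestLabeling.card_trees`). Hence off the diagonal the Hessian at `1` has entries `n ^ (n
- 4) * (4 - |e ∩ f|)`; its diagonal vanishes because the Kirchhoff polynomial is multilinear. Let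
`B` be the vertex-edge incidence matrix and `J` the all-ones matrix on vertices. As `Bᵀ * B` has
entries `|e ∩ f|` and `Bᵀ * J * B` is constantly `4`, the rescaled Hessian is `-2 • (1 + Bᵀ * C *
B)` with `C = -(J - 1) / 2`. Sylvester's identity replaces its determinant by that of `1 + C * B *
Bᵀ`, a combination of `1` and `J` (`det_four_sub_inter`). -/

open Classical in
/-- `F.IsForestLabeling π S` says that `F` is a forest whose connected components are the
nonempty fibres of `π : V → V`, with `S` as set of labels, and whose number of edges is
`|V| - |S|`. -/
structure IsForestLabeling [Fintype V] (F : SimpleGraph V) (π : V → V) (S : Finset V) : Prop where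
  isAcyclic : F.IsAcyclic
  mem_labels : ∀ v, π v ∈ S
  surj_labels : ∀ k ∈ S, ∃ v, π v = k
  reachable_iff : ∀ u v, F.Reachable u v ↔ π u = π v
  card_edges : #F.edgeFinset + #S = Fintype.card V

lemma isForestLabeling_bot [Fintype V] : (⊥ : SimpleGraph V).IsForestLabeling id univ where
  isAcyclic := isAcyclic_bot
  mem_labels := by simp
  surj_labels := by simp
  reachable_iff := by simp
  card_edges := by simp [edgeFinset]

lemma reachable_sup_edge_iff [DecidableEq V] {F : SimpleGraph V} {π : V → V}
    (h : ∀ u v, F.Reachable u v ↔ π u = π v) {a b : V} (hab : π a ≠ π b) (u v : V) :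
    (F ⊔ edge a b).Reachable u v ↔
      (if π u = π b then π a else π u) = (if π v = π b then π a else π v) := by
  have mono : ∀ {x y}, π x = π y → (F ⊔ edge a b).Reachable x y := fun hxy =>
    ((h _ _).2 hxy).mono le_sup_left
  have hne : a ≠ b := fun h => hab (by rw [h])
  have new : (F ⊔ edge a b).Reachable a b :=
    Adj.reachable (by simp [edge_adj, hne])
  constructor
  · rintro ⟨p⟩
    induction p with
    | nil => rfl
    | cons hadj _ ih =>
      rw [← ih]
      rcases hadj with hadj | hadj
      · rw [(h _ _).1 hadj.reachable]
      · rw [edge_adj] at hadj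
        rcases hadj.1 with ⟨rfl, rfl⟩ | ⟨rfl, rfl⟩ <;> simp
  · intro huv
    split_ifs at huv with h1 h2 h2
    · exact mono (h1.trans h2.symm)
    · exact (mono h1).trans (new.symm.trans (mono huv))
    · exact (mono huv).trans (new.trans (mono h2.symm))
    · exact mono huv

lemma IsForestLabeling.sup_edge [Fintype V] [DecidableEq V] {F : SimpleGraph V} {π : V → V} {S : Finset V}
    (h : F.IsForestLabeling π S) {a b : V} (hab : π a ≠ π b) :
    (F ⊔ edge a b).IsForestLabeling (fun w => if π w = π b then π a else π w)
      (S.erase (π b)) where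
  isAcyclic := h.isAcyclic.sup_edge_of_not_reachable (by rwa [h.reachable_iff])
  mem_labels v := by
    have := h.mem_labels v
    have := h.mem_labels a
    grind
  surj_labels k hk := by
    obtain ⟨v, rfl⟩ := h.surj_labels k (mem_of_mem_erase hk)
    exact ⟨v, by simp [ne_of_mem_erase hk]⟩
  reachable_iff := reachable_sup_edge_iff h.reachable_iff hab
  card_edges := by
    classical
    have h1 := h.card_edges
    have h2 : #(F ⊔ edge a b).edgeFinset = #F.edgeFinset + 1 := by
      convert card_edgeFinset_sup_edge F (fun hadj => hab ((h.reachable_iff _ _).1 hadj.reachable))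
        (fun h => hab (by rw [h]))
    have h3 := card_erase_add_one (h.mem_labels b)
    convert (by omega : #F.edgeFinset + 1 + #(S.erase (π b)) = Fintype.card V) using 2
    convert h2

open Classical in
lemma card_filter_adj [Fintype V] (G : SimpleGraph V) :
    #{p : V × V | G.Adj p.1 p.2} = 2 * #G.edgeFinset := by
  rw [← sum_degrees_eq_twice_card_edges, card_filter, Fintype.sum_prod_type]
  refine sum_congr rfl fun u _ => ?_
  rw [← card_filter, ← card_neighborFinset_eq_degree, neighborFinset_eq_filter]

/-- In an acyclic graph, adjacent vertices that are connected in a subgraph are adjacent there. -/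
lemma IsAcyclic.adj_of_reachable_of_le {F T : SimpleGraph V} (hT : T.IsAcyclic) (hle : F ≤ T)
    {u v : V} (hadj : T.Adj u v) (hr : F.Reachable u v) : F.Adj u v := by
  by_contra hF
  -- If `uv` were not in `F`, deleting it from `T` would keep `F`, hence keep `u` and `v` connected.
  have hb := isAcyclic_iff_forall_adj_isBridge.1 hT hadj
  rw [isBridge_iff] at hb
  refine hb (hr.mono fun x y hxy => ?_)
  rw [deleteEdges_adj]
  refine ⟨hle hxy, fun he => hF ?_⟩
  rw [Set.mem_singleton_iff, Sym2.eq_iff] at he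
  rcases he with ⟨rfl, rfl⟩ | ⟨rfl, rfl⟩
  · exact hxy
  · exact hxy.symm

open Classical in
-- The tree has `#S - 1` more edges than `F`, and its edges inside a fibre are exactly those of `F`.
-- Ordered pairs count each edge twice.
lemma IsForestLabeling.card_filter_adj_of_isTree [Fintype V] [DecidableEq V] {F T : SimpleGraph V} {π : V → V} {S : Finset V}
    (h : F.IsForestLabeling π S) (hT : T.IsTree) (hle : F ≤ T) :
    #{p : V × V | T.Adj p.1 p.2 ∧ π p.1 ≠ π p.2} + 2 = 2 * #S := by
  have h1 := card_filter_adj T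
  have h2 := card_filter_adj F
  have h3 := h.card_edges
  have h4 := hT.card_edgeFinset
  have h5 : #{p : V × V | T.Adj p.1 p.2} =
      #{p : V × V | F.Adj p.1 p.2} + #{p : V × V | T.Adj p.1 p.2 ∧ π p.1 ≠ π p.2} := by
    rw [← card_filter_add_card_filter_not (s := {p : V × V | T.Adj p.1 p.2})
      (fun p => π p.1 = π p.2), filter_filter, filter_filter]
    congr 2
    ext p
    simp only [mem_filter, mem_univ, true_and]
    constructor
    · rintro ⟨ha, hp⟩
      exact hT.isAcyclic.adj_of_reachable_of_le hle ha ((h.reachable_iff _ _).2 hp)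
    · exact fun ha => ⟨hle ha, (h.reachable_iff _ _).1 ha.reachable⟩
  omega

lemma IsForestLabeling.sum_inv_card_fiber [Fintype V] [DecidableEq V] {F : SimpleGraph V} {π : V → V} {S : Finset V}
    (h : F.IsForestLabeling π S) :
    ∑ u, ((#{w | π w = π u} : ℚ))⁻¹ = #S := by
  rw [← sum_fiberwise_of_maps_to (s := univ) (t := S) (g := π) fun v _ => h.mem_labels v]
  rw [card_eq_sum_ones, Nat.cast_sum]
  refine sum_congr rfl fun k hk => ?_
  obtain ⟨v, hv⟩ := h.surj_labels k hk
  have hpos : (#{w | π w = k} : ℚ) ≠ 0 := by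
    rw [Nat.cast_ne_zero, card_ne_zero]
    exact ⟨v, by simp [hv]⟩
  rw [sum_congr rfl (g := fun _ => (#{w | π w = k} : ℚ)⁻¹)
    (fun u hu => by rw [(mem_filter.1 hu).2]), sum_const, nsmul_eq_mul, mul_inv_cancel₀ hpos,
    Nat.cast_one]

lemma card_fiber_pos [Fintype V] [DecidableEq V] (π : V → V) (a : V) : 0 < #{w | π w = π a} :=
  card_pos.2 ⟨a, by simp⟩

/-- The effect of merging two fibres on the product of the cardinalities of the fibres. -/
lemma prod_card_fiber_merge [Fintype V] [DecidableEq V] {π : V → V} {S : Finset V} (hS : ∀ v, π v ∈ S)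
    {a b : V} (hab : π a ≠ π b) :
    (∏ k ∈ S.erase (π b), (#{w | (if π w = π b then π a else π w) = k} : ℚ)) =
      (((#{w | π w = π a} : ℚ))⁻¹ + ((#{w | π w = π b} : ℚ))⁻¹) *
        ∏ k ∈ S, (#{w | π w = k} : ℚ) := by
  have ha : π a ∈ S.erase (π b) := mem_erase.2 ⟨hab, hS a⟩
  rw [← mul_prod_erase S _ (hS b), ← mul_prod_erase _ _ ha, ← mul_prod_erase _ _ ha]
  have h1 : (#{w | (if π w = π b then π a else π w) = π a} : ℚ) =
      #{w | π w = π a} + #{w | π w = π b} := by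
    rw [← Nat.cast_add, ← card_union_of_disjoint]
    · congr 2
      ext w
      simp only [mem_filter, mem_univ, true_and, mem_union]
      grind
    · rw [disjoint_filter]
      grind
  have h2 : ∏ k ∈ (S.erase (π b)).erase (π a),
      (#{w | (if π w = π b then π a else π w) = k} : ℚ) =
      ∏ k ∈ (S.erase (π b)).erase (π a), (#{w | π w = k} : ℚ) := by
    refine prod_congr rfl fun k hk => ?_
    congr 2
    ext w
    simp only [mem_filter, mem_univ, true_and]
    grind
  rw [h1, h2]
  have := (Nat.cast_ne_zero (R := ℚ)).2 (card_fiber_pos π a).ne'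
  have := (Nat.cast_ne_zero (R := ℚ)).2 (card_fiber_pos π b).ne'
  field_simp
  ring

/-- For fixed `u` in a fibre of size `m`, the first summand contributes `(|V| - m) / m = |V| / m -
1`, and the inverses `1 / m` sum over `u` to the number of fibres. -/
lemma IsForestLabeling.sum_inv_add_inv [Fintype V] [DecidableEq V] {F : SimpleGraph V} {π : V → V} {S : Finset V}
    (h : F.IsForestLabeling π S) :
    ∑ p : V × V with π p.1 ≠ π p.2,
      (((#{w | π w = π p.1} : ℚ))⁻¹ + ((#{w | π w = π p.2} : ℚ))⁻¹) =
      2 * (Fintype.card V * (#S - 1)) := by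
  have key : ∑ u, ∑ v, (if π u ≠ π v then ((#{w | π w = π u} : ℚ))⁻¹ else 0) =
      Fintype.card V * (#S - 1) := by
    have : ∀ u, ∑ v, (if π u ≠ π v then ((#{w | π w = π u} : ℚ))⁻¹ else 0) =
        Fintype.card V * ((#{w | π w = π u} : ℚ))⁻¹ - 1 := by
      intro u
      rw [← sum_filter, sum_const, nsmul_eq_mul]
      have hc := card_filter_add_card_filter_not (s := (univ : Finset V)) (fun v => π v = π u)
      have hc' : #{v | ¬ π v = π u} = #{v | π u ≠ π v} := by
        congr 1; ext; simp [eq_comm]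
      rw [hc', card_univ] at hc
      have hpos := (Nat.cast_ne_zero (R := ℚ)).2 (card_fiber_pos π u).ne'
      rw [← hc, Nat.cast_add]
      field_simp
      ring
    rw [sum_congr rfl fun u _ => this u, sum_sub_distrib, ← mul_sum, h.sum_inv_card_fiber]
    simp
    ring
  rw [sum_add_distrib, two_mul]
  congr 1
  · rw [← key, sum_filter, Fintype.sum_prod_type]
  · rw [← key, sum_comm, sum_filter, Fintype.sum_prod_type]
    simp_rw [ne_comm]

open Classical in
/-- The number of trees on `V` containing a given forest. -/
theorem IsForestLabeling.card_trees [Fintype V] [DecidableEq V] [Nonempty V] {F : SimpleGraph V} {π : V → V} {S : Finset V}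
    (h : F.IsForestLabeling π S) :
    (Fintype.card V : ℚ) ^ 2 * #{T ∈ spanningTrees (⊤ : SimpleGraph V) | F ≤ T} =
      Fintype.card V ^ #S * ∏ k ∈ S, (#{w | π w = k} : ℚ) := by
  obtain ⟨c, hc⟩ : ∃ c, #S = c + 1 := by
    obtain ⟨v⟩ := ‹Nonempty V›
    exact Nat.exists_eq_succ_of_ne_zero (card_ne_zero_of_mem (h.mem_labels v))
  induction c generalizing F π S with
  | zero =>
    obtain ⟨k, rfl⟩ := card_eq_one.1 hc
    have hπ : ∀ v, π v = k := fun v => mem_singleton.1 (h.mem_labels v)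
    have hF : F.IsTree := ⟨⟨fun u v => (h.reachable_iff u v).2 ((hπ u).trans (hπ v).symm)⟩,
      h.isAcyclic⟩
    have : ({T ∈ spanningTrees (⊤ : SimpleGraph V) | F ≤ T} : Finset _) = {F} := by
      ext T
      simp only [spanningTrees, mem_filter, Set.Finite.mem_toFinset, Set.mem_ofPred_eq, le_top,
        true_and, mem_singleton]
      constructor
      · rintro ⟨hT, hle⟩
        refine le_antisymm (fun u v huv => ?_) hle
        exact hT.isAcyclic.adj_of_reachable_of_le hle huv (hF.connected u v)
      · rintro rfl
        exact ⟨hF, le_rfl⟩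
    rw [this]
    simp [hπ]
    ring
  | succ c ih =>
    -- Double count pairs of a tree `T ≥ F` and an oriented edge of `T` joining two components: each
    -- `T` has `2 * (c + 1)` of them, while for each such edge the induction hypothesis counts the
    -- trees.
    set n : ℚ := ((Fintype.card V : ℕ) : ℚ)
    set P := ∏ k ∈ S, (#{w | π w = k} : ℚ)
    have step : ∀ p : V × V, π p.1 ≠ π p.2 →
        n ^ 2 * #{T ∈ spanningTrees (⊤ : SimpleGraph V) | F ⊔ edge p.1 p.2 ≤ T} =
        n ^ (c + 1) * ((((#{w | π w = π p.1} : ℚ))⁻¹ + ((#{w | π w = π p.2} : ℚ))⁻¹) * P) := by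
      intro p hp
      have hcard : #(S.erase (π p.2)) = c + 1 := by
        rw [card_erase_of_mem (h.mem_labels _), hc]; rfl
      rw [ih (h.sup_edge hp) hcard, hcard, prod_card_fiber_merge h.mem_labels hp]
    have hsum := sum_congr rfl fun p (hp : p ∈ ({p : V × V | π p.1 ≠ π p.2} : Finset _)) =>
      step p (mem_filter.1 hp).2
    have hle : ∀ p : V × V, π p.1 ≠ π p.2 → ∀ T : SimpleGraph V,
        F ⊔ edge p.1 p.2 ≤ T ↔ F ≤ T ∧ T.Adj p.1 p.2 := by
      intro p hp T
      have : p.1 ≠ p.2 := fun h => hp (by rw [h])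
      rw [sup_le_iff, edge_le_iff]
      simp [this]
    have hdouble : ∑ p : V × V with π p.1 ≠ π p.2,
        (#{T ∈ spanningTrees (⊤ : SimpleGraph V) | F ⊔ edge p.1 p.2 ≤ T} : ℚ) =
        #{T ∈ spanningTrees (⊤ : SimpleGraph V) | F ≤ T} * (2 * (c + 1)) := by
      have h1 : ∑ p : V × V with π p.1 ≠ π p.2,
          #{T ∈ spanningTrees (⊤ : SimpleGraph V) | F ⊔ edge p.1 p.2 ≤ T} =
          ∑ T ∈ spanningTrees (⊤ : SimpleGraph V) with F ≤ T,
            #{p : V × V | T.Adj p.1 p.2 ∧ π p.1 ≠ π p.2} := by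
        rw [sum_congr rfl (g := fun p : V × V =>
          #{T ∈ ({T ∈ spanningTrees (⊤ : SimpleGraph V) | F ≤ T} : Finset _) | T.Adj p.1 p.2})]
        · refine (sum_card_bipartiteAbove_eq_sum_card_bipartiteBelow
            (fun (p : V × V) (T : SimpleGraph V) => T.Adj p.1 p.2)).trans ?_
          refine sum_congr rfl fun T _ => ?_
          rw [bipartiteBelow, filter_filter]
          simp_rw [and_comm]
        · intro p hp
          rw [filter_filter]
          simp_rw [hle p (mem_filter.1 hp).2]
      have h2 : ∀ T ∈ ({T ∈ spanningTrees (⊤ : SimpleGraph V) | F ≤ T} : Finset _),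
          #{p : V × V | T.Adj p.1 p.2 ∧ π p.1 ≠ π p.2} = 2 * (c + 1) := by
        intro T hT
        simp only [spanningTrees, mem_filter, Set.Finite.mem_toFinset, Set.mem_ofPred_eq, le_top,
          true_and] at hT
        have := h.card_filter_adj_of_isTree hT.1 hT.2
        omega
      rw [sum_congr rfl h2, sum_const, smul_eq_mul] at h1
      exact_mod_cast h1
    rw [← mul_sum, hdouble, ← mul_sum, ← sum_mul, h.sum_inv_add_inv, hc] at hsum
    push_cast at hsum
    have hc0 : (2 * (c + 1) : ℚ) ≠ 0 := by positivity
    rw [hc]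
    apply mul_right_cancel₀ hc0
    rw [mul_assoc, hsum]
    ring

end SimpleGraph

/-! ### Trees through two edges -/

namespace SimpleGraph

open Finset

section TwoEdges

variable {V : Type*} [Fintype V] [DecidableEq V]

open Classical in
lemma card_trees_two_edges {a b c d : V} (hab : a ≠ b)
    (hcd : (if c = b then a else c) ≠ (if d = b then a else d)) :
    (Fintype.card V : ℚ) ^ 2 *
        #{T ∈ spanningTrees (⊤ : SimpleGraph V) | T.Adj a b ∧ T.Adj c d} =
      Fintype.card V ^ (Fintype.card V - 2) *
        (((#{w | (if w = b then a else w) = (if c = b then a else c)} : ℚ)⁻¹ +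
          (#{w | (if w = b then a else w) = (if d = b then a else d)} : ℚ)⁻¹) * 2) := by
  have : Nonempty V := ⟨a⟩
  have h1 := (isForestLabeling_bot (V := V)).sup_edge (a := a) (b := b) hab
  have h2 := (h1.sup_edge (a := c) (b := d) hcd).card_trees
  rw [prod_card_fiber_merge h1.mem_labels hcd,
    prod_card_fiber_merge (fun v => mem_univ (id v)) (a := a) (b := b) hab,
    card_erase_of_mem (h1.mem_labels d), card_erase_of_mem (mem_univ _), card_univ] at h2
  have hle : ∀ T : SimpleGraph V,
      (⊥ ⊔ edge a b) ⊔ edge c d ≤ T ↔ T.Adj a b ∧ T.Adj c d := by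
    intro T
    have : c ≠ d := fun h => hcd (by rw [h])
    rw [bot_sup_eq, sup_le_iff, edge_le_iff, edge_le_iff]
    simp [hab, this]
  simp_rw [hle] at h2
  rw [h2, Nat.sub_sub]
  -- All fibres of `id` are singletons, so the first merge gives the factor `1⁻¹ + 1⁻¹ = 2`.
  simp [filter_eq']
  norm_num

open Classical in
lemma card_trees_adjacent_edges {a b c : V} (hab : a ≠ b) (hbc : b ≠ c) (hac : a ≠ c) :
    (Fintype.card V : ℚ) ^ 2 *
        #{T ∈ spanningTrees (⊤ : SimpleGraph V) | T.Adj a b ∧ T.Adj b c} =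
      Fintype.card V ^ (Fintype.card V - 2) * 3 := by
  rw [card_trees_two_edges hab (by simp [hbc.symm, hac])]
  have h1 : ({w | (if w = b then a else w) = a} : Finset V) = {a, b} := by
    ext w; simp; grind
  have h2 : ({w | (if w = b then a else w) = c} : Finset V) = {c} := by
    ext w; simp; grind
  simp only [if_true, hbc.symm, if_false, h1, h2, card_pair hab, card_singleton]
  norm_num

open Classical in
lemma card_trees_disjoint_edges {a b c d : V} (hab : a ≠ b) (hcd : c ≠ d)
    (hac : a ≠ c) (had : a ≠ d) (hbc : b ≠ c) (hbd : b ≠ d) :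
    (Fintype.card V : ℚ) ^ 2 *
        #{T ∈ spanningTrees (⊤ : SimpleGraph V) | T.Adj a b ∧ T.Adj c d} =
      Fintype.card V ^ (Fintype.card V - 2) * 4 := by
  rw [card_trees_two_edges hab (by simp [hbc.symm, hbd.symm, hcd])]
  have h1 : ∀ x, a ≠ x → b ≠ x →
      ({w | (if w = b then a else w) = x} : Finset V) = {x} := by
    intro x _ _
    ext w; simp; grind
  simp only [hbc.symm, hbd.symm, if_false, h1 c hac hbc, h1 d had hbd, card_singleton]
  norm_num

open Classical in
/-- The number of spanning trees of a complete graph through two distinct edges. -/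
lemma card_trees_mem_mem {e f : Sym2 V} (he : ¬ e.IsDiag) (hf : ¬ f.IsDiag) (hef : e ≠ f) :
    (Fintype.card V : ℚ) ^ 2 *
        #{T ∈ spanningTrees (⊤ : SimpleGraph V) | e ∈ T.edgeSet ∧ f ∈ T.edgeSet} =
      Fintype.card V ^ (Fintype.card V - 2) * (4 - #{v | v ∈ e ∧ v ∈ f}) := by
  induction e with | _ a b
  induction f with | _ c d
  simp only [mem_edgeSet, Sym2.mk_isDiag_iff, Sym2.mem_iff] at *
  have one : ∀ (A : Finset V) (x : V), (∀ v, v ∈ A ↔ v = x) → (4 - #A : ℚ) = 3 := by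
    intro A x h
    have : A = {x} := by ext; simp [h]
    rw [this]; norm_num
  -- Distinct edges share at most one vertex; the cases locate it.
  by_cases hac : a = c
  · subst hac
    have hbd : b ≠ d := by rintro rfl; exact hef rfl
    rw [one _ a, ← card_trees_adjacent_edges (Ne.symm he) hf hbd]
    · simp_rw [adj_comm _ a b]
    · simp; grind
  by_cases had : a = d
  · subst had
    have hbc : b ≠ c := by rintro rfl; exact hef Sym2.eq_swap
    rw [one _ a, ← card_trees_adjacent_edges (Ne.symm he) (Ne.symm hf) hbc]
    · simp_rw [adj_comm _ a b, adj_comm _ c a]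
    · simp; grind
  by_cases hbc : b = c
  · subst hbc
    rw [one _ b, ← card_trees_adjacent_edges he hf had]
    simp; grind
  by_cases hbd : b = d
  · subst hbd
    rw [one _ b, ← card_trees_adjacent_edges he (Ne.symm hf) hac]
    · simp_rw [adj_comm _ c b]
    · simp; grind
  have h0 : ({v | (v = a ∨ v = b) ∧ (v = c ∨ v = d)} : Finset V) = ∅ := by
    ext v; simp; grind
  rw [h0, card_trees_disjoint_edges he hf hac had hbc hbd]
  simp

end TwoEdges

end SimpleGraph

/-! ### Entries of the Hessian at the all-ones point -/

section Hessian

open MvPolynomial Finset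

lemma MvPolynomial.pderiv_prod_X {σ R : Type*} [CommRing R] [DecidableEq σ] (A : Finset σ)
    (j : σ) : pderiv j (∏ e ∈ A, (X e : MvPolynomial σ R)) =
      if j ∈ A then ∏ e ∈ A.erase j, X e else 0 := by
  have zero : ∀ B : Finset σ, j ∉ B → pderiv j (∏ e ∈ B, (X e : MvPolynomial σ R)) = 0 := by
    intro B hB
    induction B using Finset.induction_on with
    | empty => simp
    | insert a B ha ih =>
      rw [mem_insert, not_or] at hB
      rw [prod_insert ha, Derivation.leibniz, ih hB.2, pderiv_X_of_ne (Ne.symm hB.1)]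
      simp
  split_ifs with h
  · rw [← mul_prod_erase A _ h, Derivation.leibniz, zero _ (notMem_erase j A), pderiv_X_self]
    simp
  · exact zero A h

open Classical in
lemma hessianMatrixAtOne_apply (K : Type*) [Field K] {V : Type*} [Fintype V] (G : SimpleGraph V)
    (i j : G.edgeSet) :
    hessianMatrixAtOne K G i j = if i = j then 0 else
      (#{T ∈ spanningTrees G | i.val ∈ T.edgeSet ∧ j.val ∈ T.edgeSet} : K) := by
  simp only [hessianMatrixAtOne, hessianMatrix, Matrix.map_apply, Matrix.of_apply,
    kirchhoffPolynomial, map_sum]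
  have hterm : ∀ T : SimpleGraph V, (eval fun _ => (1 : K)) (pderiv i (pderiv j
      (∏ e ∈ Finset.univ.filter (fun e : G.edgeSet => e.val ∈ T.edgeSet), X e))) =
      if i ≠ j ∧ i.val ∈ T.edgeSet ∧ j.val ∈ T.edgeSet then 1 else 0 := by
    intro T
    rw [pderiv_prod_X]
    by_cases hj : j.val ∈ T.edgeSet
    · simp only [mem_filter, mem_univ, true_and, hj, if_true, pderiv_prod_X, mem_erase, and_true]
      split_ifs <;> simp
    · simp [hj]
  rw [sum_congr rfl fun T _ => hterm T]
  split_ifs with h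
  · simp [h]
  · simp [h]

end Hessian

/-! ### Determinant via the incidence matrix -/

section Determinant

open Finset Matrix

/-- The vertex-edge incidence matrix of `G`, with columns indexed by the edges of `G`. -/
def edgeIncMatrix (K : Type*) [Field K] {V : Type*} [DecidableEq V] (G : SimpleGraph V) :
    Matrix V G.edgeSet K :=
  Matrix.of fun v e => if v ∈ e.val then 1 else 0

variable {K : Type*} [Field K] {V : Type*} [Fintype V] [DecidableEq V]

lemma sum_edgeIncMatrix (G : SimpleGraph V) (e : G.edgeSet) :
    ∑ v, edgeIncMatrix K G v e = 2 := by
  obtain ⟨e, he⟩ := e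
  induction e with | _ a b
  have hab : a ≠ b := by rintro rfl; exact G.irrefl he
  simp only [edgeIncMatrix, Matrix.of_apply, Sym2.mem_iff, sum_boole]
  have : ({v | v = a ∨ v = b} : Finset V) = {a, b} := by ext; simp
  rw [this, card_pair hab]
  rfl

lemma transpose_mul_edgeIncMatrix_apply (G : SimpleGraph V) (e f : G.edgeSet) :
    ((edgeIncMatrix K G)ᵀ * edgeIncMatrix K G) e f = #{v | v ∈ e.val ∧ v ∈ f.val} := by
  simp [edgeIncMatrix, Matrix.mul_apply, ← ite_and, sum_boole, and_comm]

/-- A vertex lies on `n - 1` edges, and two distinct vertices lie on exactly one common edge. -/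
lemma edgeIncMatrix_top_mul_transpose [Fintype (⊤ : SimpleGraph V).edgeSet] :
    edgeIncMatrix K (⊤ : SimpleGraph V) * (edgeIncMatrix K (⊤ : SimpleGraph V))ᵀ =
      ((Fintype.card V : K) - 2) • (1 : Matrix V V K) + Matrix.of fun _ _ => 1 := by
  ext v w
  simp only [edgeIncMatrix, Matrix.mul_apply, Matrix.of_apply, Matrix.transpose_apply, mul_ite,
    mul_one, mul_zero, ← ite_and, sum_boole, Matrix.add_apply, Matrix.smul_apply, smul_eq_mul]
  by_cases hvw : v = w
  · subst hvw
    have hc : #{e : (⊤ : SimpleGraph V).edgeSet | v ∈ e.val ∧ v ∈ e.val} + 1 =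
        Fintype.card V := by
      rw [← card_univ, ← card_erase_add_one (mem_univ v)]
      congr 1
      refine (card_bij (fun u hu => ⟨s(v, u), by simpa [eq_comm] using hu⟩) ?_ ?_ ?_).symm
      · intro u hu; simp
      · intro u hu u' hu' h
        grind [Subtype.mk.injEq, Sym2.eq_iff]
      · rintro ⟨e, he⟩ hv
        simp only [mem_filter, mem_univ, true_and, and_self] at hv
        obtain ⟨u, rfl⟩ := hv
        exact ⟨u, by simpa [eq_comm] using he, rfl⟩
    rw [Matrix.one_apply_eq, ← hc]
    push_cast
    ring
  · have hc : ({e : (⊤ : SimpleGraph V).edgeSet | w ∈ e.val ∧ v ∈ e.val} : Finset _) =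
        {⟨s(v, w), by simpa using hvw⟩} := by
      ext ⟨e, he⟩
      simp only [mem_filter, mem_univ, true_and, mem_singleton, Subtype.mk.injEq]
      rw [and_comm, Sym2.mem_and_mem_iff hvw]
    simp only [and_comm] at hc ⊢
    simp [hc, hvw]

/-- The all-ones matrix has rank one, so the matrix determinant lemma applies. -/
lemma det_smul_one_sub_smul_ones (a b : K) (ha : a ≠ 0) :
    (a • (1 : Matrix V V K) - b • Matrix.of fun _ _ => 1).det =
      a ^ Fintype.card V * (1 - Fintype.card V * (b / a)) := by
  have : a • (1 : Matrix V V K) - b • (Matrix.of fun _ _ => 1) =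
      a • (1 + replicateCol Unit (fun _ : V => -(b / a)) *
        replicateRow Unit (fun _ : V => (1 : K))) := by
    ext i j
    simp [Matrix.mul_apply, mul_add]
    field_simp
    ring
  rw [this, det_smul, det_one_add_replicateCol_mul_replicateRow]
  simp [dotProduct]
  ring_nf
  simp

/-- The determinant of the matrix indexed by the edges of a complete graph with entries
`4 - |e ∩ f|` off the diagonal and `0` on the diagonal. -/
lemma det_four_sub_inter [CharZero K] [Nonempty V] [Fintype (⊤ : SimpleGraph V).edgeSet]
    [DecidableEq (⊤ : SimpleGraph V).edgeSet]
    (M : Matrix (⊤ : SimpleGraph V).edgeSet (⊤ : SimpleGraph V).edgeSet K)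
    (hM : ∀ e f, M e f = 4 - (if e = f then 2 else 0) - #{v | v ∈ e.val ∧ v ∈ f.val}) :
    M.det = (-2) ^ Fintype.card (⊤ : SimpleGraph V).edgeSet *
      ((Fintype.card V / 2 : K) ^ Fintype.card V * (4 - 2 * Fintype.card V)) := by
  set B := edgeIncMatrix K (⊤ : SimpleGraph V) with hB
  set J : Matrix V V K := Matrix.of fun _ _ => 1 with hJ
  set n : K := (Fintype.card V : K) with hn
  have hn0 : n ≠ 0 := Nat.cast_ne_zero.2 Fintype.card_ne_zero
  have hJB : Bᵀ * (J * B) = Matrix.of fun _ _ => 4 := by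
    ext e f
    simp only [hJ, Matrix.mul_apply, Matrix.of_apply, one_mul, hB, sum_edgeIncMatrix,
      Matrix.transpose_apply, ← sum_mul]
    norm_num
  have hMB : M = (-2 : K) • (1 + Bᵀ * ((-1 / 2 : K) • (J - 1) * B)) := by
    ext e f
    rw [hM, ← transpose_mul_edgeIncMatrix_apply (K := K), Matrix.smul_mul, Matrix.mul_smul,
      Matrix.sub_mul, Matrix.mul_sub, hJB, Matrix.one_mul, Matrix.smul_apply, Matrix.add_apply,
      Matrix.smul_apply, Matrix.sub_apply, Matrix.one_apply]
    simp only [Matrix.of_apply, smul_eq_mul]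
    split_ifs <;> ring
  have hJJ : J * J = n • J := by
    ext; simp [hJ, hn, Matrix.mul_apply]
  have hC : 1 + (-1 / 2 : K) • (J - 1) * B * Bᵀ =
      (n / 2) • (1 : Matrix V V K) - ((2 * n - 3) / 2) • J := by
    rw [Matrix.mul_assoc, hB, edgeIncMatrix_top_mul_transpose, Matrix.smul_mul, Matrix.sub_mul,
      Matrix.mul_add, hJJ, Matrix.one_mul, Matrix.mul_smul, Matrix.mul_one]
    ext i j
    simp only [Matrix.add_apply, Matrix.sub_apply, Matrix.smul_apply, smul_eq_mul]
    simp only [hJ, Matrix.of_apply]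
    ring
  rw [hMB, det_smul, det_one_add_mul_comm, hC, hJ,
    det_smul_one_sub_smul_ones _ _ (div_ne_zero hn0 two_ne_zero)]
  congr 2
  rw [← hn]
  field_simp
  ring

end Determinant

/-! ### The determinant formula and nonvanishing -/

theorem mainTheorem2 (K : Type*) [Field K] [CharZero K] (n : ℕ) (hn : 3 ≤ n) :
    (hessianMatrixAtOne K (⊤ : SimpleGraph (Fin n))).det =
        (-1 : K) ^ ((n.choose 2 : ℤ) - 1) * (2 : K) ^ ((n.choose 2 : ℤ) - (n : ℤ) + 1) *
          (n : K) ^ ((n : ℤ) + (n.choose 2 : ℤ) * ((n : ℤ) - 4)) * ((n : K) - 2) ∧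
      (hessianMatrix K (⊤ : SimpleGraph (Fin n))).det ≠ 0 := by
  classical
  have hn0 : (n : K) ≠ 0 := Nat.cast_ne_zero.2 (by omega)
  have : Nonempty (Fin n) := ⟨⟨0, by omega⟩⟩
  set N := n.choose 2 with hN
  have hcard : Fintype.card (⊤ : SimpleGraph (Fin n)).edgeSet = N := by
    rw [← SimpleGraph.edgeFinset_card, SimpleGraph.card_edgeFinset_top_eq_card_choose_two,
      Fintype.card_fin]
  have hdet : (hessianMatrixAtOne K (⊤ : SimpleGraph (Fin n))).det =
      (-1 : K) ^ ((N : ℤ) - 1) * (2 : K) ^ ((N : ℤ) - (n : ℤ) + 1) *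
          (n : K) ^ ((n : ℤ) + (N : ℤ) * ((n : ℤ) - 4)) * ((n : K) - 2) := by
    -- The scalar removes the factor `n ^ (n - 4)`; it is a quotient because that exponent is
    -- negative for `n = 3`.
    set M := ((n : K) ^ 4 / (n : K) ^ n) • hessianMatrixAtOne K (⊤ : SimpleGraph (Fin n)) with hM
    have hMdet := det_four_sub_inter M (by
      intro e f
      rw [hM, Matrix.smul_apply, hessianMatrixAtOne_apply, smul_eq_mul]
      split_ifs with hef
      · subst hef
        rw [← transpose_mul_edgeIncMatrix_apply (K := K)]
        have := sum_edgeIncMatrix (K := K) _ e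
        simp only [edgeIncMatrix, Matrix.of_apply] at this
        simp only [edgeIncMatrix, Matrix.mul_apply, Matrix.transpose_apply, Matrix.of_apply,
          ite_zero_mul_ite_zero, and_self, mul_one, this]
        norm_num
      · have h := SimpleGraph.card_trees_mem_mem
          ((⊤ : SimpleGraph (Fin n)).not_isDiag_of_mem_edgeSet e.2)
          ((⊤ : SimpleGraph (Fin n)).not_isDiag_of_mem_edgeSet f.2)
          (fun h => hef (Subtype.ext h))
        have h' := congrArg (Rat.cast : ℚ → K) h
        push_cast [Fintype.card_fin] at h'
        have hpow : (n : K) ^ n = n ^ (n - 2) * n ^ 2 := by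
          rw [← pow_add]; congr 1; omega
        rw [hpow, sub_zero, div_mul_eq_mul_div, div_eq_iff (by positivity)]
        linear_combination (n : K) ^ 2 * h')
    rw [hM, Matrix.det_smul, hcard, Fintype.card_fin] at hMdet
    have hpn : (n : K) ^ ((n : ℤ) + (N : ℤ) * ((n : ℤ) - 4)) =
        n ^ n * ((n : K) ^ n) ^ N / ((n : K) ^ 4) ^ N := by
      rw [show (n : ℤ) + (N : ℤ) * ((n : ℤ) - 4) = ((n + n * N : ℕ) : ℤ) - ((4 * N : ℕ) : ℤ) by
        push_cast; ring, zpow_sub₀ hn0, zpow_natCast, zpow_natCast, pow_add, pow_mul, pow_mul]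
    have hp2 : (2 : K) ^ ((N : ℤ) - (n : ℤ) + 1) = 2 ^ N * 2 / 2 ^ n := by
      rw [show (N : ℤ) - (n : ℤ) + 1 = ((N + 1 : ℕ) : ℤ) - (n : ℕ) by push_cast; ring,
        zpow_sub₀ two_ne_zero, zpow_natCast, zpow_natCast, pow_succ]
    have hp1 : (-1 : K) ^ ((N : ℤ) - 1) = - (-1) ^ N := by
      rw [zpow_sub₀ (by norm_num), zpow_natCast, zpow_one, div_neg, div_one]
    rw [hpn, hp2, hp1]
    have h2 : (-2 : K) ^ N = (-1) ^ N * 2 ^ N := by rw [← mul_pow]; norm_num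
    rw [h2, div_pow, div_pow, div_mul_eq_mul_div, div_eq_iff (by positivity)] at hMdet
    have h4 : ((n : K) ^ 4) ^ N ≠ 0 := by positivity
    rw [mul_comm, ← eq_div_iff h4] at hMdet
    rw [hMdet]
    field_simp
    ring
  refine ⟨hdet, fun h0 => ?_⟩
  -- Evaluation is a ring homomorphism, so it commutes with the determinant.
  have hmap : (hessianMatrixAtOne K (⊤ : SimpleGraph (Fin n))).det = 0 := by
    rw [hessianMatrixAtOne, ← RingHom.mapMatrix_apply, ← RingHom.map_det, h0, map_zero]
  rw [hdet] at hmap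
  have hn2 : (n : K) - 2 ≠ 0 := by
    rw [sub_ne_zero]
    exact_mod_cast (by omega : n ≠ 2)
  refine mul_ne_zero (mul_ne_zero (mul_ne_zero ?_ ?_) ?_) hn2 hmap <;>
    exact zpow_ne_zero _ (by first | exact hn0 | norm_num)
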